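/- Let $X$ and $Y$ be complex Banach spaces, let $L(Y,X)$ denote the bounded linear operators from $Y$ to $X$ (with the operator norm), and $L(X)=L(X,X)$. An operator $T\in L(X)$ is called generalized Drazin invertible if $0$ is not an accumulation point of its spectrum $\sigma(T)$, and its generalized Drazin spectrum is $$\sigma_{gD}(T)=\{\lambda\in\mathbb{C} : T-\lambda I \text{ is not generalized Drazin invertible}\}.$$ For $A\in L(X)$, $B\in L(Y)$ and $C\in L(Y,X)$ let $M_C=\begin{pmatrix} A & C\\ 0 & B\end{pmatrix}$, acting on $X\oplus Y$. On $L(Y,X)$ let $L_U(W)=UW$ for $U\in L(X)$, $R_V(W)=WV$ for $V\in L(Y)$, and $\delta_{A,B}=L_A-R_B$. For a bounded operator $S$, let $\mathcal{R}(S)$ and $\mathcal{N}(S)$ be its range and null space, and $\mathcal{N}^\infty(S)=\bigcup_{n\ge 1}\mathcal{N}(S^n)$. **Theorem.** Let $A\in L(X)$, $B\in L(Y)$ and $C\in L(Y,X)$. If $C$ belongs to the norm closure in $L(Y,X)$ of the set $$\mathcal{R}(\delta_{A,B})+\mathcal{N}(\delta_{A,B})+\bigcup_{\lambda\in\mathbb{C}}\mathcal{N}^\infty(L_{A-\lambda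 I})+\bigcup_{\lambda\in\mathbb{C}}\mathcal{N}^\infty(R_{B-\lambda I}),$$ where $+$ denotes the elementwise sum of sets, then $$\sigma_{gD}(M_C)=\sigma_{gD}(A)\cup\sigma_{gD}(B).$$ -/

import Mathlib

open scoped Pointwise

namespace GenDrazin

/-- A bounded operator `T` on a complex Banach space is generalized Drazin invertible if `0` is
not an accumulation point of its spectrum. -/
def IsGenDrazinInvertible {X : Type*} [NormedAddCommGroup X] [NormedSpace ℂ X]
    (T : X →L[ℂ] X) : Prop :=
  ¬ AccPt (0 : ℂ) (Filter.principal (spectrum ℂ T))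

/-- The generalized Drazin spectrum: all `μ` for which `T - μ I` is not generalized Drazin
invertible. -/
def gDSpectrum {X : Type*} [NormedAddCommGroup X] [NormedSpace ℂ X]
    (T : X →L[ℂ] X) : Set ℂ :=
  {μ : ℂ | ¬ IsGenDrazinInvertible (T - μ • ContinuousLinearMap.id ℂ X)}

/-- The upper triangular operator matrix `(x, y) ↦ (A x + C y, B y)` on `X ⊕ Y`
(modelled as `X × Y`, whose norm is equivalent to the other usual norms on the direct sum). -/
def upperTriangular {X Y : Type*} [NormedAddCommGroup X] [NormedSpace ℂ X]
    [NormedAddCommGroup Y] [NormedSpace ℂ Y]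
    (A : X →L[ℂ] X) (B : Y →L[ℂ] Y) (C : Y →L[ℂ] X) : (X × Y) →L[ℂ] (X × Y) :=
  (A ∘L ContinuousLinearMap.fst ℂ X Y + C ∘L ContinuousLinearMap.snd ℂ X Y).prod
    (B ∘L ContinuousLinearMap.snd ℂ X Y)

/-- Left multiplication `W ↦ U W` on `L(Y, X)`. -/
noncomputable def leftMul {X : Type*} (Y : Type*) [NormedAddCommGroup X] [NormedSpace ℂ X]
    [NormedAddCommGroup Y] [NormedSpace ℂ Y] (U : X →L[ℂ] X) :
    (Y →L[ℂ] X) →L[ℂ] (Y →L[ℂ] X) :=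
  ContinuousLinearMap.compL ℂ Y X X U

/-- Right multiplication `W ↦ W V` on `L(Y, X)`. -/
noncomputable def rightMul (X : Type*) {Y : Type*} [NormedAddCommGroup X] [NormedSpace ℂ X]
    [NormedAddCommGroup Y] [NormedSpace ℂ Y] (V : Y →L[ℂ] Y) :
    (Y →L[ℂ] X) →L[ℂ] (Y →L[ℂ] X) :=
  (ContinuousLinearMap.compL ℂ Y Y X).flip V

/-- The generalized derivation `W ↦ U W - W V` on `L(Y, X)`. -/
noncomputable def genDerivation {X Y : Type*} [NormedAddCommGroup X] [NormedSpace ℂ X]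
    [NormedAddCommGroup Y] [NormedSpace ℂ Y] (U : X →L[ℂ] X) (V : Y →L[ℂ] Y) :
    (Y →L[ℂ] X) →L[ℂ] (Y →L[ℂ] X) :=
  leftMul Y U - rightMul X V

/-- The generalized kernel: the union over `n ≥ 1` of the null spaces of `T ^ n`. -/
def genKernel {E : Type*} [NormedAddCommGroup E] [NormedSpace ℂ E] (T : E →L[ℂ] E) : Set E :=
  ⋃ n : ℕ, ⋃ _ : 1 ≤ n, {x : E | (T ^ n) x = 0}

end GenDrazin

/-!
The two sides agree because the spectra already do: `σ(M_C) = σ(A) ∪ σ(B)`, and the generalized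
Drazin spectrum of `T` is read off from the accumulation points of the spectrum of the translates
of `T`. The inclusion `σ(M_C) ⊆ σ(A) ∪ σ(B)` holds for every `C`, and if `M_C` and `B` are
invertible then so is `A`; what remains is to show that `B - μ` is invertible as soon as `M_C - μ`
is, which is where the hypothesis on `C` enters.

Suppose `M_C - ν` is invertible. Then `A - ν` is injective, `B - ν` has a bounded right inverse,
and `C` induces an injective map `ker (B - ν) → X / range (A - ν)`. If
`C = (A Z - Z B) + N + E + F` with `A N = N B`, `(A - α)ⁿ E = 0`, `F (B - β)ᵐ = 0`, and `ν ≠ α, β`,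
then each of the four terms induces the zero map: `(A Z - Z B) y = (A - ν) Z y` on `ker (B - ν)`,
`N` maps `ker (B - ν)` into `ker (A - ν) = 0`, the range of `E` lies in that of `A - ν`, and `F`
vanishes on `ker (B - ν)`. Hence `B - ν` is injective
(`injective_of_injective_upperTriangular`).

For `C` in the closure, invertibility of `M_C - μ` persists under small changes of both `C` and
`μ`, so `B - ν` is invertible for some `ν` arbitrarily close to `μ`. An operator with a bounded
right inverse that is a limit of invertible operators is invertible, which gives the claim for
`B - μ` (`isUnit_of_isUnit_upperTriangular`).
-/

namespace GenDrazin

variable {X Y : Type*} [NormedAddCommGroup X] [NormedSpace ℂ X]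
  [NormedAddCommGroup Y] [NormedSpace ℂ Y]

@[simp]
theorem upperTriangular_apply (A : X →L[ℂ] X) (B : Y →L[ℂ] Y) (C : Y →L[ℂ] X) (p : X × Y) :
    upperTriangular A B C p = (A p.1 + C p.2, B p.2) := rfl

theorem upperTriangular_sub_smul_id (A : X →L[ℂ] X) (B : Y →L[ℂ] Y) (C : Y →L[ℂ] X) (μ : ℂ) :
    upperTriangular A B C - μ • ContinuousLinearMap.id ℂ (X × Y)
      = upperTriangular (A - μ • ContinuousLinearMap.id ℂ X)
          (B - μ • ContinuousLinearMap.id ℂ Y) C := by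
  refine ContinuousLinearMap.ext fun p => Prod.ext ?_ ?_
  · simp [sub_add_eq_add_sub]
  · simp

theorem mem_spectrum_sub_smul_id (T : X →L[ℂ] X) (μ z : ℂ) :
    z ∈ spectrum ℂ (T - μ • ContinuousLinearMap.id ℂ X)
      ↔ ¬ IsUnit (T - (z + μ) • ContinuousLinearMap.id ℂ X) := by
  rw [spectrum.mem_iff, ← IsUnit.neg_iff, Algebra.algebraMap_eq_smul_one,
    show -(z • (1 : X →L[ℂ] X) - (T - μ • ContinuousLinearMap.id ℂ X))
      = T - (z + μ) • ContinuousLinearMap.id ℂ X from by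
        rw [← ContinuousLinearMap.one_def]; module]

theorem leftMul_pow_apply (U : X →L[ℂ] X) (n : ℕ) (W : Y →L[ℂ] X) :
    (leftMul Y U ^ n) W = (U ^ n) ∘L W := by
  induction n with
  | zero => rfl
  | succ n ih => rw [pow_succ', mul_apply_eq_comp, ih, pow_succ']; rfl

theorem rightMul_pow_apply (V : Y →L[ℂ] Y) (n : ℕ) (W : Y →L[ℂ] X) :
    (rightMul X V ^ n) W = W ∘L (V ^ n) := by
  induction n with
  | zero => rfl
  | succ n ih => rw [pow_succ', mul_apply_eq_comp, ih, pow_succ]; rfl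

/-- The values of `E` are in the range of `A - ν` when `(A - α)ⁿ E = 0` and `ν ≠ α`, since `A - ν`
divides `(A - α)ⁿ - (ν - α)ⁿ`. -/
theorem exists_sub_smul_id_apply_eq {A : X →L[ℂ] X} {E : Y →L[ℂ] X} {α ν : ℂ} {n : ℕ}
    (hE : ((A - α • ContinuousLinearMap.id ℂ X) ^ n) ∘L E = 0) (hν : ν ≠ α) (y : Y) :
    ∃ w, (A - ν • ContinuousLinearMap.id ℂ X) w = E y := by
  have hcomm : Commute (A - α • ContinuousLinearMap.id ℂ X)
      ((ν - α) • ContinuousLinearMap.id ℂ X) := by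
    change Commute _ ((ν - α) • (1 : X →L[ℂ] X))
    exact (Commute.one_right _).smul_right _
  have h := hcomm.mul_geom_sum₂ n
  have hdiff : A - α • ContinuousLinearMap.id ℂ X - (ν - α) • ContinuousLinearMap.id ℂ X
      = A - ν • ContinuousLinearMap.id ℂ X := by
    module
  have hpow : ((ν - α) • ContinuousLinearMap.id ℂ X) ^ n
      = (ν - α) ^ n • ContinuousLinearMap.id ℂ X := by
    change ((ν - α) • (1 : X →L[ℂ] X)) ^ n = (ν - α) ^ n • (1 : X →L[ℂ] X)
    rw [smul_pow, one_pow]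
  rw [hdiff, hpow] at h
  have hz : ((A - α • ContinuousLinearMap.id ℂ X) ^ n) (E y) = 0 := DFunLike.congr_fun hE y
  have h' := DFunLike.congr_fun h (E y)
  rw [mul_apply_eq_comp, sub_apply ((A - α • ContinuousLinearMap.id ℂ X) ^ n), hz] at h'
  have hne : (ν - α) ^ n ≠ 0 := pow_ne_zero _ (sub_ne_zero.2 hν)
  refine ⟨-((ν - α) ^ n)⁻¹ • (∑ i ∈ Finset.range n, (A - α • ContinuousLinearMap.id ℂ X) ^ i
    * ((ν - α) • ContinuousLinearMap.id ℂ X) ^ (n - 1 - i)) (E y), ?_⟩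
  rw [map_smul, h']
  simp [smul_smul, hne]

/-- `F` vanishes on the eigenspace of `B` for `ν` when `F (B - β)ᵐ = 0` and `ν ≠ β`. -/
theorem apply_eq_zero_of_comp_pow_eq_zero {B : Y →L[ℂ] Y} {F : Y →L[ℂ] X} {β ν : ℂ} {m : ℕ}
    (hF : F ∘L ((B - β • ContinuousLinearMap.id ℂ Y) ^ m) = 0) (hν : ν ≠ β) {y : Y}
    (hy : B y = ν • y) : F y = 0 := by
  have hpow : ∀ k : ℕ, ((B - β • ContinuousLinearMap.id ℂ Y) ^ k) y = (ν - β) ^ k • y := by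
    intro k
    induction k with
    | zero => simp
    | succ k ih =>
      rw [pow_succ', mul_apply_eq_comp, ih, map_smul]
      simp [hy, ← sub_smul, smul_smul, pow_succ]
  have h : F (((B - β • ContinuousLinearMap.id ℂ Y) ^ m) y) = 0 := DFunLike.congr_fun hF y
  rw [hpow, map_smul] at h
  exact (smul_eq_zero.1 h).resolve_left (pow_ne_zero _ (sub_ne_zero.2 hν))

/-- If `C` decomposes as in the hypothesis of the theorem, then the map
`ker (B - ν) → X / range (A - ν)` that it induces is zero away from the two points `α` and `β`;
this map is injective when the operator matrix is, so `B - ν` is injective. -/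
theorem injective_of_injective_upperTriangular {A : X →L[ℂ] X} {B : Y →L[ℂ] Y}
    {Z N E F : Y →L[ℂ] X} {α β ν : ℂ} {n m : ℕ} (hN : genDerivation A B N = 0)
    (hE : ((A - α • ContinuousLinearMap.id ℂ X) ^ n) ∘L E = 0)
    (hF : F ∘L ((B - β • ContinuousLinearMap.id ℂ Y) ^ m) = 0) (hα : ν ≠ α) (hβ : ν ≠ β)
    (hM : Function.Injective (upperTriangular (A - ν • ContinuousLinearMap.id ℂ X)
      (B - ν • ContinuousLinearMap.id ℂ Y) (genDerivation A B Z + N + E + F))) :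
    Function.Injective (B - ν • ContinuousLinearMap.id ℂ Y) := by
  rw [injective_iff_map_eq_zero] at hM ⊢
  intro y hy
  have hBy : B y = ν • y := by simpa [sub_eq_zero] using hy
  have hNy : N y = 0 := by
    have h : A (N y) - N (B y) = 0 := DFunLike.congr_fun hN y
    rw [hBy, map_smul] at h
    have h0 := hM (N y, 0) (by simp [h])
    exact congrArg Prod.fst h0
  obtain ⟨w, hw⟩ := exists_sub_smul_id_apply_eq hE hα y
  have hFy := apply_eq_zero_of_comp_pow_eq_zero hF hβ hBy
  have hZy : genDerivation A B Z y = (A - ν • ContinuousLinearMap.id ℂ X) (Z y) := by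
    change A (Z y) - Z (B y) = A (Z y) - ν • Z y
    rw [hBy, map_smul]
  have h0 := hM (-(Z y + w), y) (by
    refine Prod.ext ?_ hy
    rw [upperTriangular_apply]
    simp only [add_apply, map_neg, map_add, hZy, hNy, hFy, hw]
    abel_nf
    rfl)
  exact congrArg Prod.snd h0

/-- The lower right entry of the inverse of the operator matrix is a right inverse of `B`. -/
theorem exists_mul_eq_one_of_isUnit_upperTriangular {A : X →L[ℂ] X} {B : Y →L[ℂ] Y}
    {C : Y →L[ℂ] X} (hM : IsUnit (upperTriangular A B C)) : ∃ S : Y →L[ℂ] Y, B * S = 1 := by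
  obtain ⟨R, hR⟩ := hM.exists_right_inv
  refine ⟨ContinuousLinearMap.snd ℂ X Y ∘L R ∘L ContinuousLinearMap.inr ℂ X Y, ?_⟩
  ext y
  exact congrArg Prod.snd (DFunLike.congr_fun hR ((0 : X), y))

theorem continuous_upperTriangular_sub_smul_id (A : X →L[ℂ] X) (B : Y →L[ℂ] Y) :
    Continuous fun p : (Y →L[ℂ] X) × ℂ =>
      upperTriangular (A - p.2 • ContinuousLinearMap.id ℂ X)
        (B - p.2 • ContinuousLinearMap.id ℂ Y) p.1 := by
  simp_rw [← upperTriangular_sub_smul_id]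
  have h : (fun p : (Y →L[ℂ] X) × ℂ => upperTriangular A B p.1)
      = fun p => upperTriangular A B 0
        + ContinuousLinearMap.inl ℂ X Y ∘L p.1 ∘L ContinuousLinearMap.snd ℂ X Y := by
    funext p
    ext q <;> simp
  refine Continuous.sub ?_ (by fun_prop)
  rw [h]
  fun_prop

theorem exists_decomposition {A : X →L[ℂ] X} {B : Y →L[ℂ] Y} {C : Y →L[ℂ] X}
    (hC : C ∈ Set.range (genDerivation A B) + {W : Y →L[ℂ] X | genDerivation A B W = 0}
      + (⋃ μ : ℂ, genKernel (leftMul Y (A - μ • ContinuousLinearMap.id ℂ X)))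
      + (⋃ μ : ℂ, genKernel (rightMul X (B - μ • ContinuousLinearMap.id ℂ Y)))) :
    ∃ (Z N E F : Y →L[ℂ] X) (α β : ℂ) (n m : ℕ), genDerivation A B N = 0
      ∧ ((A - α • ContinuousLinearMap.id ℂ X) ^ n) ∘L E = 0
      ∧ F ∘L ((B - β • ContinuousLinearMap.id ℂ Y) ^ m) = 0
      ∧ C = genDerivation A B Z + N + E + F := by
  obtain ⟨K₁, hK₁, F, hF, rfl⟩ := Set.mem_add.1 hC
  obtain ⟨K₂, hK₂, E, hE, rfl⟩ := Set.mem_add.1 hK₁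
  obtain ⟨_, ⟨Z, rfl⟩, N, hN, rfl⟩ := Set.mem_add.1 hK₂
  simp only [genKernel, Set.mem_iUnion, Set.mem_ofPred_eq] at hE hF
  obtain ⟨α, n, -, hE⟩ := hE
  obtain ⟨β, m, -, hF⟩ := hF
  rw [leftMul_pow_apply] at hE
  rw [rightMul_pow_apply] at hF
  exact ⟨Z, N, E, F, α, β, n, m, hN, hE, hF, rfl⟩

variable [CompleteSpace X] [CompleteSpace Y]

theorem isUnit_upperTriangular {A : X →L[ℂ] X} {B : Y →L[ℂ] Y} (C : Y →L[ℂ] X)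
    (hA : IsUnit A) (hB : IsUnit B) : IsUnit (upperTriangular A B C) := by
  rw [ContinuousLinearMap.isUnit_iff_bijective] at *
  refine ⟨(injective_iff_map_eq_zero _).2 ?_, ?_⟩
  · rintro ⟨x, y⟩ h
    rw [upperTriangular_apply, Prod.mk_eq_zero] at h
    obtain rfl : y = 0 := (injective_iff_map_eq_zero _).1 hB.1 _ h.2
    obtain rfl : x = 0 := (injective_iff_map_eq_zero _).1 hA.1 _ (by simpa using h.1)
    rfl
  · rintro ⟨u, v⟩
    obtain ⟨y, rfl⟩ := hB.2 v
    obtain ⟨x, hx⟩ := hA.2 (u - C y)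
    exact ⟨(x, y), by simp [hx]⟩

theorem isUnit_left_of_isUnit_upperTriangular {A : X →L[ℂ] X} {B : Y →L[ℂ] Y} {C : Y →L[ℂ] X}
    (hM : IsUnit (upperTriangular A B C)) (hB : IsUnit B) : IsUnit A := by
  rw [ContinuousLinearMap.isUnit_iff_bijective] at *
  refine ⟨(injective_iff_map_eq_zero _).2 fun x hx => ?_, fun u => ?_⟩
  · exact congrArg Prod.fst ((injective_iff_map_eq_zero _).1 hM.1 (x, 0) (by simp [hx]))
  · obtain ⟨⟨x, y⟩, h⟩ := hM.2 (u, 0)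
    rw [upperTriangular_apply, Prod.mk.injEq] at h
    obtain rfl : y = 0 := (injective_iff_map_eq_zero _).1 hB.1 _ h.2
    exact ⟨x, by simpa using h.1⟩

/-- For `C` in the closure of the given set, `B - μ` is invertible whenever the operator matrix
translated by `μ` is. -/
theorem isUnit_of_isUnit_upperTriangular {A : X →L[ℂ] X} {B : Y →L[ℂ] Y} {C : Y →L[ℂ] X}
    (hC : C ∈ closure
      (Set.range (genDerivation A B) + {W : Y →L[ℂ] X | genDerivation A B W = 0}
        + (⋃ μ : ℂ, genKernel (leftMul Y (A - μ • ContinuousLinearMap.id ℂ X)))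
        + (⋃ μ : ℂ, genKernel (rightMul X (B - μ • ContinuousLinearMap.id ℂ Y))))) {μ : ℂ}
    (hM : IsUnit (upperTriangular (A - μ • ContinuousLinearMap.id ℂ X)
      (B - μ • ContinuousLinearMap.id ℂ Y) C)) :
    IsUnit (B - μ • ContinuousLinearMap.id ℂ Y) := by
  have hnhds : ∀ᶠ p : (Y →L[ℂ] X) × ℂ in nhds (C, μ), IsUnit (upperTriangular
      (A - p.2 • ContinuousLinearMap.id ℂ X) (B - p.2 • ContinuousLinearMap.id ℂ Y) p.1) :=
    (continuous_upperTriangular_sub_smul_id A B).continuousAt.eventually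
      (Units.isOpen.eventually_mem hM)
  rw [nhds_prod_eq, Filter.eventually_prod_iff] at hnhds
  obtain ⟨U, hU, V, hV, hUV⟩ := hnhds
  obtain ⟨S, hS⟩ := exists_mul_eq_one_of_isUnit_upperTriangular hM
  have hSnhds : ∀ᶠ ν in nhds μ, IsUnit ((B - ν • ContinuousLinearMap.id ℂ Y) * S) := by
    have hcont : Continuous fun ν : ℂ => (B - ν • ContinuousLinearMap.id ℂ Y) * S := by fun_prop
    refine hcont.continuousAt.eventually (Units.isOpen.eventually_mem ?_)
    change IsUnit ((B - μ • ContinuousLinearMap.id ℂ Y) * S)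
    rw [hS]
    exact isUnit_one
  obtain ⟨C', hC', hC'U⟩ := ((mem_closure_iff_frequently.1 hC).and_eventually hU).exists
  obtain ⟨Z, N, E, F, α, β, n, m, hN, hE, hF, hsum⟩ := exists_decomposition hC'
  -- The exceptional points `α`, `β` depend on the approximation of `C` and may equal `μ`, so a
  -- nearby `ν` replaces `μ`.
  have hdense : Dense ({α, β}ᶜ : Set ℂ) := (Set.toFinite {α, β}).countable.dense_compl ℂ
  obtain ⟨ν, hν, hνV, hνS⟩ :=
    ((mem_closure_iff_frequently.1 (hdense μ)).and_eventually (hV.and hSnhds)).exists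
  simp only [Set.mem_compl_iff, Set.mem_insert_iff, Set.mem_singleton_iff, not_or] at hν
  have hMν : IsUnit (upperTriangular (A - ν • ContinuousLinearMap.id ℂ X)
      (B - ν • ContinuousLinearMap.id ℂ Y) C') := hUV hC'U hνV
  have hinj := injective_of_injective_upperTriangular hN hE hF hν.1 hν.2
    (hsum ▸ (ContinuousLinearMap.isUnit_iff_bijective).1 hMν).1
  obtain ⟨S', hS'⟩ := exists_mul_eq_one_of_isUnit_upperTriangular hMν
  have hBν : IsUnit (B - ν • ContinuousLinearMap.id ℂ Y) :=
    (ContinuousLinearMap.isUnit_iff_bijective).2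
      ⟨hinj, fun y => ⟨S' y, DFunLike.congr_fun hS' y⟩⟩
  -- `(B - ν) S` and `B - ν` are invertible, so `S` is, and `B - μ` is its inverse.
  have hSunit : IsUnit S := hBν.mul_left_iff.1 hνS
  exact hSunit.mul_right_iff.1 (by rw [hS]; exact isUnit_one)

end GenDrazin

/-- If `C` is in the norm closure of the sum of the range and the null space of the generalized
derivation and of the two unions of generalized kernels, then the generalized Drazin spectrum of
the operator matrix is the union of those of its diagonal entries. -/
theorem mainTheorem6 {X Y : Type*}
    [NormedAddCommGroup X] [NormedSpace ℂ X] [CompleteSpace X]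
    [NormedAddCommGroup Y] [NormedSpace ℂ Y] [CompleteSpace Y]
    (A : X →L[ℂ] X) (B : Y →L[ℂ] Y) (C : Y →L[ℂ] X)
    (hC : C ∈ closure
      (Set.range (GenDrazin.genDerivation A B)
        + {W : Y →L[ℂ] X | GenDrazin.genDerivation A B W = 0}
        + (⋃ μ : ℂ, GenDrazin.genKernel
            (GenDrazin.leftMul Y (A - μ • ContinuousLinearMap.id ℂ X)))
        + (⋃ μ : ℂ, GenDrazin.genKernel
            (GenDrazin.rightMul X (B - μ • ContinuousLinearMap.id ℂ Y))))) :
    GenDrazin.gDSpectrum (GenDrazin.upperTriangular A B C)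
      = GenDrazin.gDSpectrum A ∪ GenDrazin.gDSpectrum B := by
  have hunit : ∀ z : ℂ,
      IsUnit (GenDrazin.upperTriangular A B C - z • ContinuousLinearMap.id ℂ (X × Y))
        ↔ IsUnit (A - z • ContinuousLinearMap.id ℂ X)
          ∧ IsUnit (B - z • ContinuousLinearMap.id ℂ Y) := by
    intro z
    rw [GenDrazin.upperTriangular_sub_smul_id]
    refine ⟨fun h => ?_, fun h => GenDrazin.isUnit_upperTriangular C h.1 h.2⟩
    have hB := GenDrazin.isUnit_of_isUnit_upperTriangular hC h
    exact ⟨GenDrazin.isUnit_left_of_isUnit_upperTriangular h hB, hB⟩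
  have hspec : ∀ μ : ℂ,
      spectrum ℂ (GenDrazin.upperTriangular A B C - μ • ContinuousLinearMap.id ℂ (X × Y))
        = spectrum ℂ (A - μ • ContinuousLinearMap.id ℂ X)
          ∪ spectrum ℂ (B - μ • ContinuousLinearMap.id ℂ Y) := by
    intro μ
    ext z
    rw [Set.mem_union, GenDrazin.mem_spectrum_sub_smul_id, GenDrazin.mem_spectrum_sub_smul_id,
      GenDrazin.mem_spectrum_sub_smul_id, hunit]
    tauto
  ext μ
  simp only [GenDrazin.gDSpectrum, GenDrazin.IsGenDrazinInvertible, not_not, Set.mem_union,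
    Set.mem_ofPred_eq, hspec]
  rw [← Filter.sup_principal, accPt_sup]
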